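/- Let $F$ be a field of characteristic zero and let $L$ be a nonsolvable finite-dimensional Lie algebra over $F$. A \emph{simple ideal} of $L$ is an ideal that is simple as a Lie algebra, and $\mathrm{Ssoc}(L)$ denotes the sum of all simple ideals of $L$. Let $L^*$ be a subalgebra of $L$ such that $L=\mathrm{Ssoc}(L)\oplus L^*$ as vector spaces, and suppose that $L^*$ is faithful; that is, $L^*=S\oplus \mathrm{Rad}(L^*)$ as vector spaces, with $\mathrm{Rad}(L^*)$ the solvable radical of $L^*$ and $S$ a semisimple (possibly zero) subalgebra of $L^*$ for which the restricted adjoint representation $S\to\mathfrak{gl}(\mathrm{Rad}(L^*))$, $s\mapsto (a\mapsto [s,a])$, is injective. For a Lie algebra $M$, let $\mathcal{L}_{\mathrm{id}}(M)$ be its lattice of ideals. (i) Suppose that $[\mathrm{Ssoc}(L),L^*]=0$, i.e. that $L=\mathrm{Ssoc}(L)\oplus L^*$ is a direct sum of Lie algebras. Then the ideals of $L$ are exactly the subspaces $B_s\oplus I^*$, where $B_s\subseteq \mathrm{Ssoc}(L)$ is the sum of a finite (possibly empty) set of simple ideals of $L$ and $I^*$ is an ideal of $L^*$. Moreover, $(B,I^*)\mapsto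 B\oplus I^*$ is a lattice isomorphism from the direct product $\mathcal{L}_{\mathrm{id}}(\mathrm{Ssoc}(L))\times\mathcal{L}_{\mathrm{id}}(L^*)$ onto $\mathcal{L}_{\mathrm{id}}(L)$. (ii) Even without the assumption $[\mathrm{Ssoc}(L),L^*]=0$, the lattice $\mathcal{L}_{\mathrm{id}}(L)$ is isomorphic to the direct product $\mathcal{L}_{\mathrm{id}}(\mathrm{Ssoc}(L))\times\mathcal{L}_{\mathrm{id}}(L^*)$, and $\mathcal{L}_{\mathrm{id}}(L)$ is finite if and only if $\mathcal{L}_{\mathrm{id}}(L^*)$ is finite. -/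

import Mathlib

namespace LieIdealLattice

variable (F : Type*) (L : Type*) [Field F] [LieRing L] [LieAlgebra F L]

/-- The sum of all simple ideals of `L`: the ideals of `L` that are simple as Lie algebras. -/
def ssoc : LieIdeal F L :=
  sSup {J : LieIdeal F L | LieAlgebra.IsSimple F J}

variable {L}

/-- `S` is a Levi factor of `L`: a semisimple subalgebra (zero is allowed) such that
`L = S ⊕ Rad(L)` as vector spaces. Semisimple means that the solvable radical vanishes. -/
structure IsLeviFactor (S : LieSubalgebra F L) : Prop where
  semisimple : LieAlgebra.HasTrivialRadical F S
  isCompl : IsCompl S.toSubmodule (LieAlgebra.radical F L).toSubmodule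

/-- For a Levi factor `S`, the restricted adjoint representation
`S → gl(Rad(L))`, `s ↦ (a ↦ [s, a])`, is faithful. -/
def IsFaithfulFor (S : LieSubalgebra F L) : Prop :=
  LieModule.IsFaithful F S (LieAlgebra.radical F L)

variable {F}

/-- An ideal of a subalgebra `K` of `L`, as a subspace of `L`. -/
def idealSubspace (K : LieSubalgebra F L) (I : LieIdeal F K) : Submodule F L :=
  I.toSubmodule.map K.toSubmodule.subtype

end LieIdealLattice

namespace LieIdealLattice

/-! ### Simple ideals and their sum -/

section Socle

variable {F L : Type*} [Field F] [LieRing L] [LieAlgebra F L]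

/-! A simple ideal meets any ideal `I` in zero or lies in it. If `a + c ∈ I` with `a` in the socle
and `c` centralizing the socle, bracketing with a simple `J` isolates the `J`-component of `a`; as
`J` has no center, a nonzero component forces `J ≤ I`. Hence `a ∈ I`, and ideals split along a
commuting complement.

A general complement reduces to this case: the socle has trivial radical, so in characteristic zero
its derivations are inner and its centralizer `C` is a commuting complement. Both `C` and the given
complement are isomorphic to the quotient by the socle. -/

lemma simple_le_or_inf_eq_zero (J : LieIdeal F L) (hJ : LieAlgebra.IsSimple F J)
    (I : LieIdeal F L) : J ≤ I ∨ ∀ x ∈ J, x ∈ I → x = 0 := by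
  rcases hJ.eq_bot_or_eq_top (I.comap J.incl) with h | h
  · right
    intro x hx hxI
    have : (⟨x, hx⟩ : J) ∈ I.comap J.incl := LieIdeal.mem_comap.mpr hxI
    rw [h, LieSubmodule.mem_bot] at this
    simpa using congrArg Subtype.val this
  · left
    intro x hx
    have : (⟨x, hx⟩ : J) ∈ I.comap J.incl := h ▸ LieSubmodule.mem_top _
    exact LieIdeal.mem_comap.mp this

lemma lie_eq_zero_of_simple_ne {J₁ J₂ : LieIdeal F L} (h₁ : LieAlgebra.IsSimple F J₁)
    (h₂ : LieAlgebra.IsSimple F J₂) (hne : J₁ ≠ J₂) {x y : L} (hx : x ∈ J₁) (hy : y ∈ J₂) :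
    ⁅x, y⁆ = 0 := by
  rcases simple_le_or_inf_eq_zero J₁ h₁ J₂ with h | h
  · rcases simple_le_or_inf_eq_zero J₂ h₂ J₁ with h' | h'
    · exact absurd (le_antisymm h h') hne
    · rw [h' x (h hx) hx, zero_lie]
  · exact h _ (lie_mem_left F L J₁ x y hx) (lie_mem_right F L J₂ x y hy)

lemma eq_zero_of_simple_of_lie_eq_zero (J : LieIdeal F L) (hJ : LieAlgebra.IsSimple F J)
    {z : L} (hz : z ∈ J) (h : ∀ y ∈ J, ⁅y, z⁆ = 0) : z = 0 := by
  have hc : (⟨z, hz⟩ : J) ∈ LieAlgebra.center F J :=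
    fun y => Subtype.ext (h y y.2)
  rw [LieAlgebra.center_eq_bot, LieSubmodule.mem_bot] at hc
  exact congrArg Subtype.val hc

lemma simple_le_ssoc {J : LieIdeal F L} (hJ : LieAlgebra.IsSimple F J) : J ≤ ssoc F L :=
  le_sSup hJ

/-- The socle component of an element of an ideal is a sum of elements of simple ideals contained
in that ideal. -/
lemma mem_sSup_simple_le (I : LieIdeal F L) {a c : L} (ha : a ∈ ssoc F L)
    (hc : ∀ y ∈ ssoc F L, ⁅y, c⁆ = 0) (h : a + c ∈ I) :
    a ∈ sSup {J : LieIdeal F L | LieAlgebra.IsSimple F J ∧ J ≤ I} := by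
  rw [ssoc, sSup_eq_iSup', ← LieSubmodule.mem_toSubmodule, LieSubmodule.iSup_toSubmodule,
    Submodule.mem_iSup_iff_exists_finsupp] at ha
  obtain ⟨f, hf, rfl⟩ := ha
  refine sum_mem fun J _ => ?_
  by_cases hfJ : f J = 0
  · simp [hfJ]
  -- Distinct simple ideals commute and `c` centralizes the socle, so only the `J`-component
  -- survives.
  have key : ∀ y ∈ J.1, ⁅y, f J⁆ = ⁅y, (f.sum fun _ x => x) + c⁆ := by
    intro y hy
    rw [lie_add, hc y (simple_le_ssoc J.2 hy), add_zero, Finsupp.sum, lie_sum,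
      Finset.sum_eq_single J]
    · intro K _ hK
      exact lie_eq_zero_of_simple_ne J.2 K.2 (fun e => hK (Subtype.ext e.symm)) hy (hf K)
    · intro hJ
      rw [Finsupp.notMem_support_iff.mp hJ, lie_zero]
  have hle : J.1 ≤ I := by
    rcases simple_le_or_inf_eq_zero J.1 J.2 I with h' | h'
    · exact h'
    · refine absurd (eq_zero_of_simple_of_lie_eq_zero J.1 J.2 (hf J) fun y hy => ?_) hfJ
      refine h' _ (lie_mem_right F L J.1 _ _ (hf J)) ?_
      rw [key y hy]
      exact lie_mem_right F L I _ _ h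
  have hmem : J.1 ∈ {J : LieIdeal F L | LieAlgebra.IsSimple F J ∧ J ≤ I} := ⟨J.2, hle⟩
  exact le_sSup hmem (hf J)

lemma socle_component_mem (I : LieIdeal F L) {a c : L} (ha : a ∈ ssoc F L)
    (hc : ∀ y ∈ ssoc F L, ⁅y, c⁆ = 0) (h : a + c ∈ I) : a ∈ I :=
  (sSup_le fun _ hJ => hJ.2 : sSup {J : LieIdeal F L | LieAlgebra.IsSimple F J ∧ J ≤ I} ≤ I)
    (mem_sSup_simple_le I ha hc h)

lemma eq_zero_of_mem_ssoc_of_lie_eq_zero {z : L} (hz : z ∈ ssoc F L)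
    (h : ∀ y ∈ ssoc F L, ⁅y, z⁆ = 0) : z = 0 := by
  -- Such a `z` centralizes the socle, so `z + (-z) ∈ ⊥` has socle component `z`.
  have := socle_component_mem (F := F) ⊥ (c := -z) hz
    (fun y hy => by rw [lie_neg, h y hy, neg_zero]) (by simp)
  simpa using this

variable (F L) in
/-- The sum of the simple ideals has trivial solvable radical. -/
lemma hasTrivialRadical_ssoc : LieAlgebra.HasTrivialRadical F (ssoc F L) := by
  rw [LieAlgebra.hasTrivialRadical_iff_no_abelian_ideals]
  intro I hI
  rw [LieSubmodule.eq_bot_iff]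
  rintro ⟨x, hx⟩ hxI
  have hcomm : ∀ J : LieIdeal F L, LieAlgebra.IsSimple F J → ∀ y ∈ J, ⁅y, x⁆ = 0 := by
    intro J hJ y hy
    have hle := simple_le_ssoc hJ
    rcases hJ.eq_bot_or_eq_top (I.comap (LieIdeal.inclusion hle)) with h | h
    · have : (⟨⁅y, x⁆, lie_mem_left F L J y x hy⟩ : J) ∈ I.comap (LieIdeal.inclusion hle) :=
        LieIdeal.mem_comap.mpr (lie_mem_right F (ssoc F L) I ⟨y, hle hy⟩ ⟨x, hx⟩ hxI)
      rw [h, LieSubmodule.mem_bot] at this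
      exact congrArg Subtype.val this
    -- Here `J` lies inside the abelian ideal `I`, which is impossible.
    · refine absurd ⟨fun u v => Subtype.ext ?_⟩ hJ.non_abelian
      have hmem : ∀ w : J, LieIdeal.inclusion hle w ∈ I := fun w =>
        LieIdeal.mem_comap.mp (h ▸ LieSubmodule.mem_top w)
      exact congrArg (fun t : I => (t.1 : L))
        (hI.trivial ⟨_, hmem u⟩ ⟨_, hmem v⟩)
  refine Subtype.ext (eq_zero_of_mem_ssoc_of_lie_eq_zero hx fun y hy => ?_)
  rw [ssoc, sSup_eq_iSup', ← LieSubmodule.mem_toSubmodule, LieSubmodule.iSup_toSubmodule] at hy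
  induction hy using Submodule.iSup_induction' with
  | mem J y hy => exact hcomm J.1 J.2 y hy
  | zero => exact zero_lie x
  | add y z _ _ h₁ h₂ => rw [add_lie, h₁, h₂, add_zero]

lemma exists_finset_simple_sup_eq [FiniteDimensional F L] (I : LieIdeal F L)
    (hI : I ≤ ssoc F L) :
    ∃ T : Finset (LieIdeal F L), (∀ J ∈ T, LieAlgebra.IsSimple F J) ∧ T.sup id = I := by
  obtain ⟨T, hT, hsup⟩ := CompleteLattice.WellFoundedGT.isSupFiniteCompact (LieIdeal F L)
    {J : LieIdeal F L | LieAlgebra.IsSimple F J ∧ J ≤ I}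
  refine ⟨T, fun J hJ => (hT hJ).1, ?_⟩
  rw [← hsup]
  refine le_antisymm (sSup_le fun _ hJ => hJ.2) fun x hx => ?_
  exact mem_sSup_simple_le I (c := 0) (hI hx) (by simp) (by simpa using hx)

end Socle

/-! ### Ideals of commuting summands -/

section Complement

variable {F L : Type*} [Field F] [LieRing L] [LieAlgebra F L]

lemma mem_idealSubspace {K : LieSubalgebra F L} {I : LieIdeal F K} {x : L} :
    x ∈ idealSubspace K I ↔ ∃ y ∈ I, (y : L) = x := by
  simp [idealSubspace]

lemma idealSubspace_le (K : LieSubalgebra F L) (I : LieIdeal F K) :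
    idealSubspace K I ≤ K.toSubmodule := by
  intro x hx
  obtain ⟨y, -, rfl⟩ := mem_idealSubspace.mp hx
  exact y.2

lemma idealSubspace_le_iff {K : LieSubalgebra F L} {I I' : LieIdeal F K} :
    idealSubspace K I ≤ idealSubspace K I' ↔ I ≤ I' :=
  Submodule.map_le_map_iff_of_injective K.toSubmodule.injective_subtype _ _

variable {A K : LieSubalgebra F L}

/-- If `A` and `K` commute and span `L`, then the sum of an ideal of `A` and an ideal of `K` is an
ideal of `L`. -/
def supIdeal (hcomm : ∀ x ∈ A, ∀ y ∈ K, ⁅x, y⁆ = 0)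
    (hsup : A.toSubmodule ⊔ K.toSubmodule = ⊤) (B : LieIdeal F A) (I : LieIdeal F K) :
    LieIdeal F L where
  __ := idealSubspace A B ⊔ idealSubspace K I
  lie_mem := by
    intro x m hm
    obtain ⟨a, ha, c, hc, rfl⟩ := Submodule.mem_sup.mp (hsup ▸ Submodule.mem_top (x := x))
    obtain ⟨_, hb', _, hd', rfl⟩ := Submodule.mem_sup.mp hm
    obtain ⟨b, hb, rfl⟩ := mem_idealSubspace.mp hb'
    obtain ⟨d, hd, rfl⟩ := mem_idealSubspace.mp hd'
    have h₁ : ⁅a, (d : L)⁆ = 0 := hcomm a ha d d.2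
    have h₂ : ⁅c, (b : L)⁆ = 0 := by rw [← lie_skew, hcomm b b.2 c hc, neg_zero]
    rw [add_lie, lie_add, lie_add, h₁, h₂, add_zero, zero_add]
    exact Submodule.add_mem_sup
      (mem_idealSubspace.mpr ⟨_, lie_mem_right F A B ⟨a, ha⟩ b hb, rfl⟩)
      (mem_idealSubspace.mpr ⟨_, lie_mem_right F K I ⟨c, hc⟩ d hd, rfl⟩)

/-- By the modular law, intersecting with `P` or `Q` recovers each summand. -/
lemma sup_le_sup_iff_of_disjoint {V : Type*} [AddCommGroup V] [Module F V]
    {P Q P₁ P₂ Q₁ Q₂ : Submodule F V} (hd : Disjoint P Q) (h₁ : P₁ ≤ P) (h₂ : P₂ ≤ P)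
    (k₁ : Q₁ ≤ Q) (k₂ : Q₂ ≤ Q) : P₁ ⊔ Q₁ ≤ P₂ ⊔ Q₂ ↔ P₁ ≤ P₂ ∧ Q₁ ≤ Q₂ := by
  refine ⟨fun h => ⟨?_, ?_⟩, fun h => sup_le_sup h.1 h.2⟩
  · calc P₁ ≤ (P₂ ⊔ Q₂) ⊓ P := le_inf (le_sup_left.trans h) h₁
      _ = P₂ ⊔ Q₂ ⊓ P := sup_inf_assoc_of_le _ h₂
      _ ≤ P₂ := by rw [(hd.symm.mono_left k₂).eq_bot, sup_bot_eq]
  · calc Q₁ ≤ (Q₂ ⊔ P₂) ⊓ Q := le_inf (le_sup_right.trans (h.trans (sup_comm _ _).le)) k₁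
      _ = Q₂ ⊔ P₂ ⊓ Q := sup_inf_assoc_of_le _ k₂
      _ ≤ Q₂ := by rw [(hd.mono_left h₂).eq_bot, sup_bot_eq]

lemma idealSubspace_comap_incl (K : LieSubalgebra F L) (I : LieIdeal F L) :
    idealSubspace K (I.comap K.incl) = I.toSubmodule ⊓ K.toSubmodule := by
  ext x
  rw [mem_idealSubspace, Submodule.mem_inf]
  constructor
  · rintro ⟨y, hy, rfl⟩
    exact ⟨LieIdeal.mem_comap.mp hy, y.2⟩
  · rintro ⟨hx, hxK⟩
    exact ⟨⟨x, hxK⟩, LieIdeal.mem_comap.mpr hx, rfl⟩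

end Complement

/-! ### The ideal lattice as a product -/

section Isomorphism

variable {F L : Type*} [Field F] [LieRing L] [LieAlgebra F L]

lemma eq_inf_sup_inf_of_commuting_complement {K : LieSubalgebra F L}
    (hcompl : IsCompl (ssoc F L).toSubmodule K.toSubmodule)
    (hcomm : ∀ x ∈ ssoc F L, ∀ y ∈ K, ⁅x, y⁆ = 0) (I : LieIdeal F L) :
    I.toSubmodule ⊓ (ssoc F L).toSubmodule ⊔ I.toSubmodule ⊓ K.toSubmodule = I.toSubmodule := by
  refine le_antisymm (sup_le inf_le_left inf_le_left) fun x hx => ?_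
  obtain ⟨a, ha, c, hc, rfl⟩ :=
    Submodule.mem_sup.mp (hcompl.sup_eq_top ▸ Submodule.mem_top (x := x))
  have haI : a ∈ I := socle_component_mem I ha (fun y hy => hcomm y hy c hc) hx
  exact Submodule.add_mem_sup ⟨haI, ha⟩ ⟨(add_mem_cancel_left haI).mp hx, hc⟩

/-- If the sum of all simple ideals has a commuting complement `K`, then the ideals of `L` are the
sums of an ideal of this sum and an ideal of `K`. -/
noncomputable def prodOrderIso {K : LieSubalgebra F L}
    (hcompl : IsCompl (ssoc F L).toSubmodule K.toSubmodule)
    (hcomm : ∀ x ∈ ssoc F L, ∀ y ∈ K, ⁅x, y⁆ = 0) :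
    LieIdeal F (ssoc F L) × LieIdeal F K ≃o LieIdeal F L :=
  RelIso.ofSurjective
    (OrderEmbedding.ofMapLEIff
      (fun p : LieIdeal F (ssoc F L) × LieIdeal F K =>
        supIdeal (A := (ssoc F L).toLieSubalgebra) hcomm hcompl.sup_eq_top p.1 p.2)
      fun p q =>
        (sup_le_sup_iff_of_disjoint hcompl.disjoint
          (idealSubspace_le (ssoc F L).toLieSubalgebra _)
          (idealSubspace_le (ssoc F L).toLieSubalgebra _)
          (idealSubspace_le K _) (idealSubspace_le K _)).trans
            (and_congr idealSubspace_le_iff idealSubspace_le_iff))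
    fun I => by
      refine ⟨(I.comap (ssoc F L).toLieSubalgebra.incl, I.comap K.incl), ?_⟩
      rw [← LieSubmodule.toSubmodule_inj]
      refine Eq.trans ?_ (eq_inf_sup_inf_of_commuting_complement hcompl hcomm I)
      exact congrArg₂ (· ⊔ ·)
        (idealSubspace_comap_incl (ssoc F L).toLieSubalgebra I) (idealSubspace_comap_incl K I)

lemma prodOrderIso_toSubmodule {K : LieSubalgebra F L}
    (hcompl : IsCompl (ssoc F L).toSubmodule K.toSubmodule)
    (hcomm : ∀ x ∈ ssoc F L, ∀ y ∈ K, ⁅x, y⁆ = 0)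
    (B : LieIdeal F (ssoc F L)) (I : LieIdeal F K) :
    (prodOrderIso hcompl hcomm (B, I)).toSubmodule =
      idealSubspace (ssoc F L).toLieSubalgebra B ⊔ idealSubspace K I := rfl

/-- The lattice isomorphism between the ideals of isomorphic Lie algebras. -/
def idealOrderIso {L' : Type*} [LieRing L'] [LieAlgebra F L'] (e : L ≃ₗ⁅F⁆ L') :
    LieIdeal F L ≃o LieIdeal F L' where
  toFun I := I.comap e.symm.toLieHom
  invFun I := I.comap e.toLieHom
  left_inv I := by ext x; simp [LieIdeal.mem_comap]
  right_inv I := by ext x; simp [LieIdeal.mem_comap]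
  map_rel_iff' {I J} := by
    refine ⟨fun h x hx => ?_, fun h x hx => h hx⟩
    have := @h (e x) (by simpa [LieIdeal.mem_comap] using hx)
    simpa [LieIdeal.mem_comap] using this

/-- A subalgebra complementary to an ideal is isomorphic to the quotient. -/
noncomputable def equivQuotientOfIsCompl (A : LieIdeal F L) (K : LieSubalgebra F L)
    (h : IsCompl A.toSubmodule K.toSubmodule) : K ≃ₗ⁅F⁆ L ⧸ A :=
  { (Submodule.quotientEquivOfIsCompl A.toSubmodule K.toSubmodule h).symm with
    map_lie' := by
      intro x y
      exact LieSubmodule.Quotient.mk_bracket A (x : L) (y : L) }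

section FiniteDimensional

variable [CharZero F] [FiniteDimensional F L]

variable (F L)

/-- Each `x` acts on the socle as an inner derivation `ad a`, so `x - a` centralizes the socle; the
intersection is zero because the socle is centerless. -/
lemma isCompl_ssoc_centralizer :
    IsCompl (ssoc F L).toSubmodule (LieModule.ker F L (ssoc F L)).toSubmodule := by
  constructor
  · rw [Submodule.disjoint_def]
    intro x hx hxC
    refine eq_zero_of_mem_ssoc_of_lie_eq_zero hx fun y hy => ?_
    have := (LieModule.mem_ker F L (ssoc F L) x).mp hxC ⟨y, hy⟩
    rw [← lie_skew, neg_eq_zero]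
    exact congrArg Subtype.val this
  · rw [codisjoint_iff, eq_top_iff]
    intro x _
    have := hasTrivialRadical_ssoc F L
    let D : LieDerivation F (ssoc F L) (ssoc F L) :=
      { LieModule.toEnd F L (ssoc F L) x with
        leibniz' := fun a b => Subtype.ext <| by
          change ⁅x, ⁅(a : L), (b : L)⁆⁆ = ⁅(a : L), ⁅x, (b : L)⁆⁆ - ⁅(b : L), ⁅x, (a : L)⁆⁆
          rw [leibniz_lie, ← lie_skew ⁅x, (a : L)⁆ (b : L)]
          abel }
    obtain ⟨a, ha⟩ := LieDerivation.IsKilling.exists_eq_ad D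
    refine Submodule.mem_sup.mpr ⟨a, a.2, x - a, ?_, add_sub_cancel _ _⟩
    refine (LieModule.mem_ker F L (ssoc F L) _).mpr fun b => Subtype.ext ?_
    have hb : ⁅(a : L), (b : L)⁆ = ⁅x, (b : L)⁆ :=
      congrArg Subtype.val
        ((by simp : ⁅a, b⁆ = LieDerivation.ad F (ssoc F L) a b).trans (DFunLike.congr_fun ha b))
    change ⁅x - (a : L), (b : L)⁆ = 0
    rw [sub_lie, hb, sub_self]

/-- A semisimple algebra has finitely many minimal ideals, since they are independent, and every
ideal is a sum of some of them. -/
lemma finite_lieIdeal_ssoc : Finite (LieIdeal F (ssoc F L)) := by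
  have := hasTrivialRadical_ssoc F L
  have hfin : {I : LieIdeal F (ssoc F L) | IsAtom I}.Finite :=
    WellFoundedGT.finite_of_sSupIndep LieAlgebra.IsSemisimple.sSupIndep_isAtom
  refine Set.finite_univ_iff.mp ((hfin.finite_subsets.image sSup).subset fun I _ => ?_)
  obtain ⟨T, hT, rfl⟩ := (LieAlgebra.IsSemisimple.booleanGenerators F (ssoc F L)).atomistic I
    (by rw [LieAlgebra.IsSemisimple.sSup_atoms_eq_top]; exact le_top)
  exact ⟨T, hT, rfl⟩

variable {F L}

/-- The ideal lattice of `L` is a product as soon as the sum of all simple ideals has a complement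
that is a subalgebra. -/
noncomputable def orderIsoProd {K : LieSubalgebra F L}
    (hcompl : IsCompl (ssoc F L).toSubmodule K.toSubmodule) :
    LieIdeal F L ≃o LieIdeal F (ssoc F L) × LieIdeal F K :=
  let C := (LieModule.ker F L (ssoc F L)).toLieSubalgebra
  have hC : IsCompl (ssoc F L).toSubmodule C.toSubmodule := isCompl_ssoc_centralizer F L
  let e : LieIdeal F C ≃o LieIdeal F K :=
    idealOrderIso ((equivQuotientOfIsCompl (ssoc F L) C hC).trans
      (equivQuotientOfIsCompl (ssoc F L) K hcompl).symm)
  (prodOrderIso hC fun x hx y hy => by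
    rw [← lie_skew, neg_eq_zero]
    exact congrArg Subtype.val
      ((LieModule.mem_ker F L (ssoc F L) y).mp hy ⟨x, hx⟩)).symm.trans
    { Equiv.prodCongr (Equiv.refl _) e.toEquiv with
      map_rel_iff' := and_congr Iff.rfl e.le_iff_le }

end FiniteDimensional

lemma exists_toSubmodule_eq_iff [FiniteDimensional F L] {K : LieSubalgebra F L}
    (hcompl : IsCompl (ssoc F L).toSubmodule K.toSubmodule)
    (hcomm : ∀ x ∈ ssoc F L, ∀ y ∈ K, ⁅x, y⁆ = 0) (W : Submodule F L) :
    (∃ I : LieIdeal F L, I.toSubmodule = W) ↔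
      ∃ (T : Finset (LieIdeal F L)) (I : LieIdeal F K),
        (∀ J ∈ T, LieAlgebra.IsSimple F J) ∧ T.sup id ≤ ssoc F L ∧
        Disjoint (T.sup id).toSubmodule (idealSubspace K I) ∧
        W = (T.sup id).toSubmodule ⊔ idealSubspace K I := by
  constructor
  · rintro ⟨I, rfl⟩
    obtain ⟨T, hT, hsup⟩ := exists_finset_simple_sup_eq (I ⊓ ssoc F L) inf_le_right
    have hle : T.sup id ≤ ssoc F L := hsup ▸ inf_le_right
    refine ⟨T, I.comap K.incl, hT, hle, hcompl.disjoint.mono hle (idealSubspace_le _ _), ?_⟩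
    rw [hsup, idealSubspace_comap_incl]
    exact (eq_inf_sup_inf_of_commuting_complement hcompl hcomm I).symm
  · rintro ⟨T, I, -, hle, -, rfl⟩
    refine ⟨prodOrderIso hcompl hcomm
      ((T.sup id).comap (ssoc F L).toLieSubalgebra.incl, I), ?_⟩
    have h : idealSubspace (ssoc F L).toLieSubalgebra
        ((T.sup id).comap (ssoc F L).toLieSubalgebra.incl) = (T.sup id).toSubmodule :=
      (idealSubspace_comap_incl _ _).trans (inf_eq_left.mpr hle)
    exact congrArg (· ⊔ idealSubspace K I) h

end Isomorphism

end LieIdealLattice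

theorem mainTheorem9 {F L : Type*} [Field F] [CharZero F] [LieRing L] [LieAlgebra F L]
    [FiniteDimensional F L] (hL : ¬ LieAlgebra.IsSolvable L)
    (Lstar : LieSubalgebra F L)
    (S : LieSubalgebra F Lstar)
    (hS : LieIdealLattice.IsLeviFactor F S)
    (hfaithful : LieIdealLattice.IsFaithfulFor F S)
    (hcompl : IsCompl (LieIdealLattice.ssoc F L).toSubmodule Lstar.toSubmodule) :
    -- When the sum is a direct sum of Lie algebras: the ideals, and the explicit isomorphism.
    ((∀ x ∈ LieIdealLattice.ssoc F L, ∀ y ∈ Lstar, ⁅x, y⁆ = 0) →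
      (∀ W : Submodule F L,
        (∃ I : LieIdeal F L, I.toSubmodule = W) ↔
          ∃ (T : Finset (LieIdeal F L)) (Istar : LieIdeal F Lstar),
            (∀ J ∈ T, LieAlgebra.IsSimple F J) ∧
            T.sup id ≤ LieIdealLattice.ssoc F L ∧
            Disjoint (T.sup id).toSubmodule (LieIdealLattice.idealSubspace Lstar Istar) ∧
            W = (T.sup id).toSubmodule ⊔ LieIdealLattice.idealSubspace Lstar Istar) ∧
      (∃ e : LieIdeal F (LieIdealLattice.ssoc F L) × LieIdeal F Lstar ≃o LieIdeal F L,
        ∀ (B : LieIdeal F (LieIdealLattice.ssoc F L)) (Istar : LieIdeal F Lstar),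
          (e (B, Istar)).toSubmodule =
            LieIdealLattice.idealSubspace (LieIdealLattice.ssoc F L).toLieSubalgebra B ⊔
              LieIdealLattice.idealSubspace Lstar Istar)) ∧
    -- For a sum that is direct as vector spaces only.
    Nonempty (LieIdeal F L ≃o LieIdeal F (LieIdealLattice.ssoc F L) × LieIdeal F Lstar) ∧
    (Finite (LieIdeal F L) ↔ Finite (LieIdeal F Lstar)) := by
  refine ⟨fun hcomm => ⟨LieIdealLattice.exists_toSubmodule_eq_iff hcompl hcomm,
    LieIdealLattice.prodOrderIso hcompl hcomm,
    LieIdealLattice.prodOrderIso_toSubmodule hcompl hcomm⟩,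
    ⟨LieIdealLattice.orderIsoProd hcompl⟩, ?_⟩
  have := LieIdealLattice.finite_lieIdeal_ssoc F L
  rw [(LieIdealLattice.orderIsoProd hcompl).toEquiv.finite_iff]
  exact ⟨fun _ => Finite.prod_right (LieIdeal F (LieIdealLattice.ssoc F L)),
    fun _ => inferInstance⟩
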